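/- Let $S$ be a finite set. Let $b : 2^S \to \mathbb{Z}\cup\{+\infty\}$ be a set function with $b(\emptyset)=0$ that is submodular, i.e. $b(X)+b(Y)\ge b(X\cap Y)+b(X\cup Y)$ for all $X,Y\subseteq S$ with $b(X),b(Y)<+\infty$. Suppose that the integral base-polyhedron $$B=\Bigl\{x\in\mathbb{R}^S : \sum_{v\in S}x(v)=b(S),\ \sum_{v\in Z}x(v)\le b(Z)\ \text{for every } Z\subseteq S\Bigr\}$$ is nonempty ($B$ may be unbounded). An element $x$ of $B\cap\mathbb{Z}^S$ is called decreasingly minimal (dec-min) if, for every $y\in B\cap\mathbb{Z}^S$, the vector of the components of $x$ arranged in decreasing order is equal to, or lexicographically smaller than, the vector of the components of $y$ arranged in decreasing order. Then $B$ has a unique point of minimum Euclidean norm, and this point is a convex combination of dec-min elements of $B\cap\mathbb{Z}^S$. -/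

import Mathlib

/-- A set function `b` with values in `R ∪ {+∞}` is submodular if the submodular inequality holds
for all pairs of sets at which `b` is finite. -/
def IsSubmodular {S R : Type*} [DecidableEq S] [Add R] [LE R]
    (b : Finset S → WithTop R) : Prop :=
  ∀ X Y : Finset S, b X ≠ ⊤ → b Y ≠ ⊤ → b (X ∩ Y) + b (X ∪ Y) ≤ b X + b Y

/-- The (possibly unbounded) polyhedron
`B(b) = {x ∈ ℝ^S : x(S) = b(S), x(Z) ≤ b(Z) for every Z ⊆ S}`. -/
def basePolyhedron {S : Type*} [Fintype S] (b : Finset S → WithTop ℝ) :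
    Set (EuclideanSpace ℝ S) :=
  {x | ((∑ v, x v : ℝ) : WithTop ℝ) = b Finset.univ ∧
    ∀ Z : Finset S, ((∑ v ∈ Z, x v : ℝ) : WithTop ℝ) ≤ b Z}

/-- An integral base-polyhedron: one described by an integer-valued (possibly `+∞`)
submodular set function `b` with `b(∅) = 0`. -/
def IsIntegralBasePolyhedron {S : Type*} [Fintype S] [DecidableEq S]
    (B : Set (EuclideanSpace ℝ S)) : Prop :=
  ∃ b : Finset S → WithTop ℤ, b ∅ = 0 ∧ IsSubmodular b ∧
    B = basePolyhedron (fun Z => (b Z).map (fun k : ℤ => (k : ℝ)))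

/-- The set of integral members of `B`. -/
def integralPoints {S : Type*} (B : Set (EuclideanSpace ℝ S)) : Set (EuclideanSpace ℝ S) :=
  {x | x ∈ B ∧ ∀ s, ∃ k : ℤ, x s = (k : ℝ)}

/-- The components of `x` rearranged in decreasing order. -/
noncomputable def decSeq {S : Type*} [Fintype S] (x : EuclideanSpace ℝ S) : List ℝ :=
  (Finset.univ.val.map fun s => x s).sort (· ≥ ·)

/-- `x` and `y` are value-equivalent. -/
def ValueEquivalent {S : Type*} [Fintype S] (x y : EuclideanSpace ℝ S) : Prop :=
  decSeq x = decSeq y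

/-- `x` is decreasingly smaller than `y`: the decreasing rearrangement of `x` is
lexicographically smaller than that of `y`. -/
def DecSmaller {S : Type*} [Fintype S] (x y : EuclideanSpace ℝ S) : Prop :=
  List.Lex (· < ·) (decSeq x) (decSeq y)

/-- `x` is a decreasingly minimal element of `Q`. -/
def IsDecMin {S : Type*} [Fintype S] (Q : Set (EuclideanSpace ℝ S))
    (x : EuclideanSpace ℝ S) : Prop :=
  x ∈ Q ∧ ∀ y ∈ Q, DecSmaller x y ∨ ValueEquivalent x y

/-- `m` is a point of `B` with minimum Euclidean norm. -/
def IsMinNormPoint {S : Type*} [Fintype S] (B : Set (EuclideanSpace ℝ S))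
    (m : EuclideanSpace ℝ S) : Prop :=
  m ∈ B ∧ ∀ x ∈ B, ‖m‖ ≤ ‖x‖

/-!
The minimum norm point `m` is characterised by `⟪m, x - m⟫ ≥ 0` on `B`. If `m s < m t`, then
`m` cannot be moved in the direction `χ_s - χ_t` inside `B`, so some tight set contains `s` but not
`t`. By submodularity tight sets form a lattice, hence every level set `{v | m v ≤ c}` is tight.

Consider the points `x` of `B` that stay tight on the integral level sets of `m` and satisfy
`⌊m v⌋ ≤ x v ≤ ⌈m v⌉`. They form a compact convex set containing `m`, and its extreme points are
integral: a minimal tight set meeting the non-integral coordinates of `x` contains two of them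
(its sum is an integer), and these can be shifted against each other in both directions. By
Krein–Milman, `m` is a convex combination of integral points of this kind.

Each such `x` minimises `∑ v, (x v - k)⁺` over `B` for every integer `k`, because the coordinates
with `x v > k` lie outside the tight set `{v | m v ≤ k}` and those with `x v < k` inside. Comparing
these sums at the first place where the sorted vectors differ shows that `x` is dec-min.
-/

open Filter Topology

section SetLattice

variable {α : Type*} [DecidableEq α] {𝓛 : Set (Finset α)}

theorem mem_of_isSublattice_of_separated [Fintype α] (h𝓛 : IsSublattice 𝓛) (hbot : ∅ ∈ 𝓛)
    (htop : Finset.univ ∈ 𝓛) {L : Finset α}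
    (hsep : ∀ s ∈ L, ∀ t ∉ L, ∃ Z ∈ 𝓛, s ∈ Z ∧ t ∉ Z) : L ∈ 𝓛 := by
  have hnhd : ∀ s ∈ L, ∃ Z ∈ 𝓛, s ∈ Z ∧ Z ⊆ L := by
    intro s hs
    choose! Z hZ hsZ htZ using hsep s hs
    refine ⟨Lᶜ.inf Z, Finset.inf_mem 𝓛 htop (fun _ hX _ hY => h𝓛.infClosed hX hY) _ _
      fun t ht => hZ t (Finset.mem_compl.1 ht), ?_, fun v hv => ?_⟩
    · exact Finset.mem_inf.2 fun t ht => hsZ t (Finset.mem_compl.1 ht)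
    · by_contra hvL
      exact htZ v hvL (Finset.mem_inf.1 hv v (Finset.mem_compl.2 hvL))
  choose! Z hZ hsZ hZL using hnhd
  have hL : L.sup Z = L := (Finset.sup_le hZL).antisymm fun s hs =>
    Finset.mem_sup.2 ⟨s, hs, hsZ s hs⟩
  rw [← hL]
  exact Finset.sup_mem 𝓛 hbot (fun _ hX _ hY => h𝓛.supClosed hX hY) _ _ hZ

theorem exists_forall_subset_of_infClosed (h𝓛 : InfClosed 𝓛) {p : α → Prop}
    (hp : ∃ Z ∈ 𝓛, ∃ v ∈ Z, p v) :
    ∃ T ∈ 𝓛, (∃ v ∈ T, p v) ∧ ∀ Z ∈ 𝓛, ∀ v ∈ T, p v → v ∈ Z → T ⊆ Z := by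
  obtain ⟨T, ⟨hT, hpT⟩, hmin⟩ :=
    exists_minimal_of_wellFoundedLT (fun Z => Z ∈ 𝓛 ∧ ∃ v ∈ Z, p v) hp
  refine ⟨T, hT, hpT, fun Z hZ v hvT hv hvZ => ?_⟩
  have hTZ : T ≤ T ⊓ Z :=
    hmin ⟨h𝓛 hT hZ, v, Finset.mem_inter.2 ⟨hvT, hvZ⟩, hv⟩ inf_le_left
  exact hTZ.trans inf_le_right

end SetLattice

theorem exists_ne_notMem_of_sum_mem {ι G : Type*} [AddCommGroup G] {H : AddSubgroup G}
    {T : Finset ι} {f : ι → G} (hsum : ∑ i ∈ T, f i ∈ H) {s : ι} (hs : s ∈ T) (hfs : f s ∉ H) :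
    ∃ t ∈ T, t ≠ s ∧ f t ∉ H := by
  classical
  by_contra! hrest
  have hmem : ∑ i ∈ T.erase s, f i ∈ H := H.sum_mem fun i hi =>
    hrest i (Finset.mem_of_mem_erase hi) (Finset.ne_of_mem_erase hi)
  rw [← Finset.add_sum_erase _ _ hs] at hsum
  exact hfs ((H.add_mem_cancel_right hmem).1 hsum)

theorem eq_zero_of_mem_extremePoints_of_eventually {E : Type*} [AddCommGroup E] [Module ℝ E]
    {A : Set E} {x d : E} (hx : x ∈ A.extremePoints ℝ)
    (hpos : ∀ᶠ δ : ℝ in 𝓝[>] 0, x + δ • d ∈ A) (hneg : ∀ᶠ δ : ℝ in 𝓝[>] 0, x + δ • -d ∈ A) :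
    d = 0 := by
  obtain ⟨δ, ⟨hadd, hsub⟩, hδ⟩ := ((hpos.and hneg).and self_mem_nhdsWithin).exists
  rw [smul_neg, ← sub_eq_add_neg] at hsub
  have hfixed : x + δ • d = x := hx.2 hadd hsub (mem_openSegment_add_sub x (δ • d))
  exact (smul_eq_zero.1 (left_eq_add.1 hfixed.symm)).resolve_left (ne_of_gt hδ)

theorem eventually_add_mul_le {a c e : ℝ} (hac : a ≤ c) (he : a = c → e ≤ 0) :
    ∀ᶠ δ : ℝ in 𝓝[>] 0, a + δ * e ≤ c := by
  rcases hac.eq_or_lt with rfl | hlt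
  · filter_upwards [self_mem_nhdsWithin] with δ hδ
    exact add_le_of_nonpos_right (mul_nonpos_of_nonneg_of_nonpos (le_of_lt hδ) (he rfl))
  · have hcont : Continuous fun δ : ℝ => a + δ * e := by fun_prop
    have hlim : Tendsto (fun δ : ℝ => a + δ * e) (𝓝[>] 0) (𝓝 a) :=
      (hcont.tendsto' 0 a (by simp)).mono_left nhdsWithin_le_nhds
    exact hlim.eventually_le_const hlt

section Coordinates

variable {S : Type*}

theorem isLinearMap_sum_apply (Z : Finset S) :
    IsLinearMap ℝ fun x : EuclideanSpace ℝ S => ∑ v ∈ Z, x v :=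
  ⟨fun x y => by simp [Finset.sum_add_distrib], fun c x => by simp [Finset.mul_sum]⟩

theorem sum_add_smul_apply (Z : Finset S) (x d : EuclideanSpace ℝ S) (δ : ℝ) :
    ∑ v ∈ Z, (x + δ • d) v = ∑ v ∈ Z, x v + δ * ∑ v ∈ Z, d v := by
  rw [(isLinearMap_sum_apply Z).map_add, (isLinearMap_sum_apply Z).map_smul, smul_eq_mul]

/-- The direction `χ_s - χ_t`, along which a base exchanges weight between `t` and `s`. -/
noncomputable def exchange [DecidableEq S] (s t : S) : EuclideanSpace ℝ S :=
  EuclideanSpace.single s 1 - EuclideanSpace.single t 1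

theorem neg_exchange [DecidableEq S] (s t : S) : -exchange s t = exchange t s :=
  neg_sub _ _

theorem exchange_apply_of_ne [DecidableEq S] {s t v : S} (hs : v ≠ s) (ht : v ≠ t) :
    exchange s t v = 0 := by
  simp [exchange, hs, ht]

theorem exchange_ne_zero [DecidableEq S] {s t : S} (hst : s ≠ t) : exchange s t ≠ 0 := by
  intro h
  simpa [exchange, hst] using congrArg (fun z : EuclideanSpace ℝ S => z s) h

theorem sum_exchange [DecidableEq S] (Z : Finset S) (s t : S) :
    ∑ v ∈ Z, exchange s t v = (if s ∈ Z then 1 else 0) - (if t ∈ Z then 1 else 0) := by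
  simp [exchange, Finset.sum_sub_distrib]

theorem inner_exchange [Fintype S] [DecidableEq S] (x : EuclideanSpace ℝ S) (s t : S) :
    inner ℝ x (exchange s t) = x s - x t := by
  simp [exchange, inner_sub_right, EuclideanSpace.inner_single_right]

/-- The vectors whose coordinates lie between those of `l` and `u`. -/
def box (l u : S → ℝ) : Set (EuclideanSpace ℝ S) :=
  {x | ∀ v, x v ∈ Set.Icc (l v) (u v)}

theorem convex_box (l u : S → ℝ) : Convex ℝ (box l u) :=
  fun _ hx _ hy _ _ hp hq hpq v => convex_Icc (l v) (u v) (hx v) (hy v) hp hq hpq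

theorem isCompact_box (l u : S → ℝ) : IsCompact (box l u) := by
  have hpre : box l u = PiLp.homeomorph 2 (fun _ : S => ℝ) ⁻¹'
      Set.univ.pi fun v => Set.Icc (l v) (u v) := by
    ext x
    exact Set.mem_univ_pi.symm
  rw [hpre, Homeomorph.isCompact_preimage]
  exact isCompact_univ_pi fun v => isCompact_Icc

theorem finite_integralPoints_box [Finite S] (l u : S → ℝ) : (integralPoints (box l u)).Finite := by
  have hIcc : ∀ v, ((↑) '' Set.Icc ⌈l v⌉ ⌊u v⌋ : Set ℝ).Finite := fun v =>
    (Set.finite_Icc _ _).image _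
  refine ((Set.Finite.pi' hIcc).preimage (WithLp.ofLp_injective 2).injOn).subset ?_
  rintro x ⟨hx, hint⟩ v
  obtain ⟨k, hk⟩ := hint v
  have hkv : (k : ℝ) ∈ Set.Icc (l v) (u v) := hk ▸ hx v
  exact ⟨k, Int.preimage_Icc.subset hkv, hk.symm⟩

theorem eventually_add_smul_mem_box [Finite S] {l u : S → ℝ} {x d : EuclideanSpace ℝ S}
    (hx : x ∈ box l u) (hl : ∀ v, x v = l v → 0 ≤ d v) (hu : ∀ v, x v = u v → d v ≤ 0) :
    ∀ᶠ δ : ℝ in 𝓝[>] 0, x + δ • d ∈ box l u := by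
  refine eventually_all.2 fun v => ?_
  have hlower := eventually_add_mul_le (neg_le_neg (hx v).1) (e := -d v) fun h =>
    neg_nonpos.2 (hl v (neg_injective h))
  filter_upwards [hlower, eventually_add_mul_le (hx v).2 (hu v)] with δ hδl hδu
  rw [mul_neg, ← neg_add, neg_le_neg_iff] at hδl
  exact ⟨hδl, hδu⟩

end Coordinates

theorem IsSubmodular.map {S R R' : Type*} [DecidableEq S] [AddZeroClass R] [Preorder R]
    [AddZeroClass R'] [Preorder R'] {b : Finset S → WithTop R} (hb : IsSubmodular b)
    (f : R →+ R') (hf : Monotone f) : IsSubmodular fun Z => (b Z).map f := by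
  intro X Y hX hY
  simp only [← WithTop.map_add]
  exact hf.withTop_map (hb X Y (fun h => hX (by simp [h])) fun h => hY (by simp [h]))

section Tight

variable {S : Type*}

/-- `Z` is tight for `x` when the constraint `x(Z) ≤ b(Z)` holds with equality. In particular
`b(Z)` is finite. -/
def IsTight (b : Finset S → WithTop ℝ) (x : EuclideanSpace ℝ S) (Z : Finset S) : Prop :=
  ((∑ v ∈ Z, x v : ℝ) : WithTop ℝ) = b Z

variable {b : Finset S → WithTop ℝ} {x d : EuclideanSpace ℝ S}

theorem IsTight.add_smul {Z : Finset S} (hZ : IsTight b x Z) (hd : ∑ v ∈ Z, d v = 0) (δ : ℝ) :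
    IsTight b (x + δ • d) Z := by
  rwa [IsTight, sum_add_smul_apply, hd, mul_zero, add_zero]

theorem isClosed_setOf_isTight (b : Finset S → WithTop ℝ) (Z : Finset S) :
    IsClosed {x | IsTight b x Z} := by
  unfold IsTight
  cases b Z with
  | top => simp
  | coe c =>
    simp only [WithTop.coe_inj]
    exact isClosed_eq (by fun_prop) continuous_const

theorem convex_setOf_isTight (b : Finset S → WithTop ℝ) (Z : Finset S) :
    Convex ℝ {x | IsTight b x Z} := by
  unfold IsTight
  cases b Z with
  | top => simpa using convex_empty
  | coe c =>
    simp only [WithTop.coe_inj]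
    exact convex_hyperplane (isLinearMap_sum_apply Z) c

theorem isClosed_setOf_sum_le (Z : Finset S) (c : WithTop ℝ) :
    IsClosed {x : EuclideanSpace ℝ S | ((∑ v ∈ Z, x v : ℝ) : WithTop ℝ) ≤ c} := by
  cases c with
  | top => simp
  | coe c =>
    simp only [WithTop.coe_le_coe]
    exact isClosed_le (by fun_prop) continuous_const

theorem convex_setOf_sum_le (Z : Finset S) (c : WithTop ℝ) :
    Convex ℝ {x : EuclideanSpace ℝ S | ((∑ v ∈ Z, x v : ℝ) : WithTop ℝ) ≤ c} := by
  cases c with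
  | top => simpa using convex_univ
  | coe c =>
    simp only [WithTop.coe_le_coe]
    exact convex_halfSpace_le (isLinearMap_sum_apply Z) c

variable [Fintype S]

theorem basePolyhedron_eq_inter (b : Finset S → WithTop ℝ) :
    basePolyhedron b = {x | IsTight b x Finset.univ} ∩
      ⋂ Z, {x | ((∑ v ∈ Z, x v : ℝ) : WithTop ℝ) ≤ b Z} := by
  ext x
  simp [basePolyhedron, IsTight]

theorem isClosed_basePolyhedron (b : Finset S → WithTop ℝ) : IsClosed (basePolyhedron b) := by
  rw [basePolyhedron_eq_inter]
  exact (isClosed_setOf_isTight b _).inter (isClosed_iInter fun Z => isClosed_setOf_sum_le Z _)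

theorem convex_basePolyhedron (b : Finset S → WithTop ℝ) : Convex ℝ (basePolyhedron b) := by
  rw [basePolyhedron_eq_inter]
  exact (convex_setOf_isTight b _).inter (convex_iInter fun Z => convex_setOf_sum_le Z _)

theorem isSublattice_setOf_isTight [DecidableEq S] (hb : IsSubmodular b)
    (hx : x ∈ basePolyhedron b) : IsSublattice {Z | IsTight b x Z} := by
  have hboth : ∀ X Y, IsTight b x X → IsTight b x Y →
      IsTight b x (X ∩ Y) ∧ IsTight b x (X ∪ Y) := by
    intro X Y hX hY
    have hsub := hb X Y (hX ▸ WithTop.coe_ne_top) (hY ▸ WithTop.coe_ne_top)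
    have hinter := hx.2 (X ∩ Y)
    have hunion := hx.2 (X ∪ Y)
    rw [← hX, ← hY, ← WithTop.coe_add, ← Finset.sum_union_inter] at hsub
    unfold IsTight
    cases hi : b (X ∩ Y) with
    | top => simp [hi] at hsub
    | coe p =>
      cases hu : b (X ∪ Y) with
      | top => simp [hu] at hsub
      | coe q =>
        rw [hi, hu, ← WithTop.coe_add, WithTop.coe_le_coe] at hsub
        rw [hi, WithTop.coe_le_coe] at hinter
        rw [hu, WithTop.coe_le_coe] at hunion
        constructor <;> rw [WithTop.coe_inj] <;> linarith
  exact ⟨fun X hX Y hY => (hboth X Y hX hY).2, fun X hX Y hY => (hboth X Y hX hY).1⟩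

theorem eventually_add_smul_mem_basePolyhedron (hx : x ∈ basePolyhedron b)
    (hd : ∑ v, d v = 0) (htight : ∀ Z, IsTight b x Z → ∑ v ∈ Z, d v ≤ 0) :
    ∀ᶠ δ : ℝ in 𝓝[>] 0, x + δ • d ∈ basePolyhedron b := by
  have hle : ∀ Z, ∀ᶠ δ : ℝ in 𝓝[>] 0,
      ((∑ v ∈ Z, (x + δ • d) v : ℝ) : WithTop ℝ) ≤ b Z := by
    intro Z
    have hxZ := hx.2 Z
    have hdZ := htight Z
    unfold IsTight at hdZ
    cases hbZ : b Z with
    | top => simp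
    | coe c =>
      rw [hbZ, WithTop.coe_le_coe] at hxZ
      rw [hbZ, WithTop.coe_inj] at hdZ
      simpa only [WithTop.coe_le_coe, sum_add_smul_apply] using eventually_add_mul_le hxZ hdZ
  filter_upwards [eventually_all.2 hle] with δ hδ
  exact ⟨IsTight.add_smul hx.1 hd δ, hδ⟩

end Tight

section Face

variable {S : Type*} [Fintype S]

/-- The face of the base-polyhedron on which all members of `𝓕` are tight. -/
def tightFace (b : Finset S → WithTop ℝ) (𝓕 : Set (Finset S)) : Set (EuclideanSpace ℝ S) :=
  {x ∈ basePolyhedron b | ∀ Z ∈ 𝓕, IsTight b x Z}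

theorem tightFace_eq_inter (b : Finset S → WithTop ℝ) (𝓕 : Set (Finset S)) :
    tightFace b 𝓕 = basePolyhedron b ∩ ⋂ Z ∈ 𝓕, {x | IsTight b x Z} := by
  ext x
  simp [tightFace]

theorem isClosed_tightFace (b : Finset S → WithTop ℝ) (𝓕 : Set (Finset S)) :
    IsClosed (tightFace b 𝓕) := by
  rw [tightFace_eq_inter]
  exact (isClosed_basePolyhedron b).inter (isClosed_biInter fun Z _ => isClosed_setOf_isTight b Z)

theorem convex_tightFace (b : Finset S → WithTop ℝ) (𝓕 : Set (Finset S)) :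
    Convex ℝ (tightFace b 𝓕) := by
  rw [tightFace_eq_inter]
  exact (convex_basePolyhedron b).inter (convex_iInter₂ fun Z _ => convex_setOf_isTight b Z)

variable {b : Finset S → WithTop ℝ} {𝓕 : Set (Finset S)} {x d : EuclideanSpace ℝ S}

theorem eventually_add_smul_mem_tightFace (hx : x ∈ tightFace b 𝓕)
    (hd : ∀ Z, IsTight b x Z → ∑ v ∈ Z, d v = 0) :
    ∀ᶠ δ : ℝ in 𝓝[>] 0, x + δ • d ∈ tightFace b 𝓕 := by
  have hbase := eventually_add_smul_mem_basePolyhedron hx.1 (hd _ hx.1.1) fun Z hZ => (hd Z hZ).le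
  filter_upwards [hbase] with δ hδ
  exact ⟨hδ, fun Z hZ => (hx.2 Z hZ).add_smul (hd Z (hx.2 Z hZ)) δ⟩

variable {H : AddSubgroup ℝ} {l u : S → ℝ}

theorem exists_ne_notMem_isTight_iff [DecidableEq S] (hb : IsSubmodular b)
    (hbH : ∀ Z (c : ℝ), b Z = c → c ∈ H) (hx : x ∈ basePolyhedron b) {r : S} (hr : x r ∉ H) :
    ∃ s t, s ≠ t ∧ x s ∉ H ∧ x t ∉ H ∧ ∀ Z, IsTight b x Z → (s ∈ Z ↔ t ∈ Z) := by
  obtain ⟨T, hT, ⟨s, hsT, hs⟩, hmin⟩ := exists_forall_subset_of_infClosed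
    (isSublattice_setOf_isTight hb hx).infClosed (p := fun v => x v ∉ H)
    ⟨Finset.univ, hx.1, r, Finset.mem_univ r, hr⟩
  obtain ⟨t, htT, hts, ht⟩ := exists_ne_notMem_of_sum_mem (hbH T _ hT.symm) hsT hs
  exact ⟨s, t, hts.symm, hs, ht, fun Z hZ =>
    ⟨fun hsZ => hmin Z hZ s hsT hs hsZ htT, fun htZ => hmin Z hZ t htT ht htZ hsT⟩⟩

theorem eventually_add_smul_exchange_mem_tightFace_inter_box [DecidableEq S]
    (hl : ∀ v, l v ∈ H) (hu : ∀ v, u v ∈ H) (hx : x ∈ tightFace b 𝓕 ∩ box l u) {s t : S}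
    (hs : x s ∉ H) (ht : x t ∉ H) (hst : ∀ Z, IsTight b x Z → (s ∈ Z ↔ t ∈ Z)) :
    ∀ᶠ δ : ℝ in 𝓝[>] 0, x + δ • exchange s t ∈ tightFace b 𝓕 ∩ box l u := by
  have hsum : ∀ Z, IsTight b x Z → ∑ v ∈ Z, exchange s t v = 0 := fun Z hZ => by
    simp only [sum_exchange, hst Z hZ, sub_self]
  have hfixed : ∀ v, x v ∈ H → exchange s t v = 0 := fun v hv =>
    exchange_apply_of_ne (fun h => hs (h ▸ hv)) fun h => ht (h ▸ hv)
  exact (eventually_add_smul_mem_tightFace hx.1 hsum).and <| eventually_add_smul_mem_box hx.2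
    (fun v hv => (hfixed v (hv ▸ hl v)).ge) fun v hv => (hfixed v (hv ▸ hu v)).le

theorem apply_mem_of_mem_extremePoints_tightFace_inter_box [DecidableEq S] (hb : IsSubmodular b)
    (hbH : ∀ Z (c : ℝ), b Z = c → c ∈ H) (hl : ∀ v, l v ∈ H) (hu : ∀ v, u v ∈ H)
    (hx : x ∈ (tightFace b 𝓕 ∩ box l u).extremePoints ℝ) (v : S) : x v ∈ H := by
  by_contra hv
  obtain ⟨s, t, hst, hs, ht, htight⟩ := exists_ne_notMem_isTight_iff hb hbH hx.1.1.1 hv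
  refine exchange_ne_zero hst (eq_zero_of_mem_extremePoints_of_eventually hx
    (eventually_add_smul_exchange_mem_tightFace_inter_box hl hu hx.1 hs ht htight) ?_)
  rw [neg_exchange]
  exact eventually_add_smul_exchange_mem_tightFace_inter_box hl hu hx.1 ht hs
    fun Z hZ => (htight Z hZ).symm

theorem tightFace_inter_box_subset_convexHull_integralPoints [DecidableEq S] (hb : IsSubmodular b)
    (hbint : ∀ Z (c : ℝ), b Z = c → c ∈ (Int.castAddHom ℝ).range)
    (hl : ∀ v, l v ∈ (Int.castAddHom ℝ).range) (hu : ∀ v, u v ∈ (Int.castAddHom ℝ).range) :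
    tightFace b 𝓕 ∩ box l u ⊆ convexHull ℝ (integralPoints (tightFace b 𝓕 ∩ box l u)) := by
  set P := tightFace b 𝓕 ∩ box l u
  have hcompact : IsCompact P := (isCompact_box l u).inter_left (isClosed_tightFace b 𝓕)
  have hconvex : Convex ℝ P := (convex_tightFace b 𝓕).inter (convex_box l u)
  have hfinite : (integralPoints P).Finite :=
    (finite_integralPoints_box l u).subset fun x hx => ⟨hx.1.2, hx.2⟩
  have hextreme : P.extremePoints ℝ ⊆ integralPoints P := fun x hx => ⟨hx.1, fun v =>
    (apply_mem_of_mem_extremePoints_tightFace_inter_box hb hbint hl hu hx v).imp fun _ => Eq.symm⟩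
  calc P = closure (convexHull ℝ (P.extremePoints ℝ)) :=
        (closure_convexHull_extremePoints hcompact hconvex).symm
    _ ⊆ convexHull ℝ (integralPoints P) :=
        closure_minimal (convexHull_mono hextreme) (hfinite.isClosed_convexHull ℝ)

end Face

section MinNorm

variable {S : Type*} [Fintype S] {B : Set (EuclideanSpace ℝ S)} {m : EuclideanSpace ℝ S}

theorem isMinNormPoint_iff_inner_nonneg (hB : Convex ℝ B) (hm : m ∈ B) :
    IsMinNormPoint B m ↔ ∀ x ∈ B, 0 ≤ inner ℝ m (x - m) := by
  have hbdd : BddBelow (Set.range fun x : B => ‖0 - (x : EuclideanSpace ℝ S)‖) :=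
    ⟨0, Set.forall_mem_range.2 fun _ => norm_nonneg _⟩
  have hinf : IsMinNormPoint B m ↔ ‖0 - m‖ = ⨅ x : B, ‖0 - (x : EuclideanSpace ℝ S)‖ := by
    have : Nonempty B := ⟨⟨m, hm⟩⟩
    constructor
    · exact fun h => le_antisymm (le_ciInf fun x => by simpa using h.2 x x.2)
        (ciInf_le hbdd ⟨m, hm⟩)
    · exact fun h => ⟨hm, fun x hx => by simpa using h.le.trans (ciInf_le hbdd ⟨x, hx⟩)⟩
  rw [hinf, norm_eq_iInf_iff_real_inner_le_zero hB hm]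
  simp only [zero_sub, inner_neg_left, neg_nonpos]

theorem existsUnique_isMinNormPoint (hne : B.Nonempty) (hclosed : IsClosed B)
    (hconv : Convex ℝ B) : ∃! m, IsMinNormPoint B m := by
  obtain ⟨m, hm, hinf⟩ := exists_norm_eq_iInf_of_complete_convex hne hclosed.isComplete hconv 0
  rw [norm_eq_iInf_iff_real_inner_le_zero hconv hm] at hinf
  have hmin : ∀ x ∈ B, 0 ≤ inner ℝ m (x - m) := by
    simpa only [zero_sub, inner_neg_left, neg_nonpos] using hinf
  refine ⟨m, (isMinNormPoint_iff_inner_nonneg hconv hm).2 hmin, fun y hy => ?_⟩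
  have hymin := (isMinNormPoint_iff_inner_nonneg hconv hy.1).1 hy m hm
  have hdist : inner ℝ (y - m) (y - m) ≤ 0 := calc
    inner ℝ (y - m) (y - m) = -inner ℝ y (m - y) - inner ℝ m (y - m) := by
      rw [inner_sub_left, ← inner_neg_right, neg_sub]
    _ ≤ 0 := by linarith [hmin y hy.1]
  exact sub_eq_zero.1 (real_inner_self_nonpos.1 hdist)

/-- The set of elements at which `m` takes a value at most `c`. -/
noncomputable def lowerLevelSet (m : EuclideanSpace ℝ S) (c : ℝ) : Finset S := {v | m v ≤ c}

theorem mem_lowerLevelSet {c : ℝ} {v : S} : v ∈ lowerLevelSet m c ↔ m v ≤ c := by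
  simp [lowerLevelSet]

variable {b : Finset S → WithTop ℝ}

theorem IsMinNormPoint.exists_isTight_of_lt (hm : IsMinNormPoint (basePolyhedron b) m)
    {s t : S} (hst : m s < m t) : ∃ Z, IsTight b m Z ∧ s ∈ Z ∧ t ∉ Z := by
  classical
  by_contra! hcon
  have hfeas : ∀ᶠ δ : ℝ in 𝓝[>] 0, m + δ • exchange s t ∈ basePolyhedron b := by
    refine eventually_add_smul_mem_basePolyhedron hm.1 (by simp [sum_exchange]) fun Z hZ => ?_
    rw [sum_exchange, sub_nonpos]
    by_cases hs : s ∈ Z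
    · simp [hs, hcon Z hZ hs]
    · rw [if_neg hs]
      positivity
  obtain ⟨δ, hmem, hδ⟩ := (hfeas.and self_mem_nhdsWithin).exists
  have hinner := (isMinNormPoint_iff_inner_nonneg (convex_basePolyhedron b) hm.1).1 hm _ hmem
  rw [add_sub_cancel_left, inner_smul_right, inner_exchange] at hinner
  exact (mul_neg_of_pos_of_neg hδ (sub_neg.2 hst)).not_ge hinner

theorem IsMinNormPoint.isTight_lowerLevelSet [DecidableEq S] (h0 : b ∅ = 0)
    (hb : IsSubmodular b) (hm : IsMinNormPoint (basePolyhedron b) m) (c : ℝ) :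
    IsTight b m (lowerLevelSet m c) := by
  refine mem_of_isSublattice_of_separated (isSublattice_setOf_isTight hb hm.1)
    (by simp [IsTight, h0]) hm.1.1 fun s hs t ht => hm.exists_isTight_of_lt ?_
  rw [mem_lowerLevelSet] at hs ht
  exact hs.trans_lt (not_le.1 ht)

end MinNorm

section DecMin

theorem lex_or_eq_of_sum_posPart_sub_le {α : Type*} [AddCommGroup α] [LinearOrder α]
    [IsOrderedAddMonoid α] {l₁ l₂ : List α} (hlen : l₁.length = l₂.length)
    (hl₂ : l₂.Pairwise (· ≥ ·))
    (h : ∀ c ∈ l₂, (l₁.map fun a => (a - c)⁺).sum ≤ (l₂.map fun a => (a - c)⁺).sum) :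
    List.Lex (· < ·) l₁ l₂ ∨ l₁ = l₂ := by
  induction l₁ generalizing l₂ with
  | nil => exact Or.inr (List.length_eq_zero_iff.1 hlen.symm).symm
  | cons a l₁ ih =>
    cases l₂ with
    | nil => simp at hlen
    | cons c l₂ =>
      rw [List.pairwise_cons] at hl₂
      rcases lt_trichotomy a c with hac | rfl | hca
      · exact Or.inl (List.Lex.rel hac)
      · have htail := ih (by simpa using hlen) hl₂.2 fun k hk => by
          simpa using h k (List.mem_cons_of_mem _ hk)
        exact htail.imp List.Lex.cons (congrArg (a :: ·))
      · have hright : ((c :: l₂).map fun a => (a - c)⁺).sum = 0 := by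
          refine List.sum_eq_zero (List.forall_mem_map.2 fun e he => ?_)
          rcases List.mem_cons.1 he with rfl | he
          · simp
          · simpa using hl₂.1 e he
        have hleft : 0 < ((a :: l₁).map fun a => (a - c)⁺).sum := by
          rw [List.map_cons, List.sum_cons]
          refine add_pos_of_pos_of_nonneg (posPart_pos (sub_pos.2 hca)) ?_
          exact List.sum_nonneg (List.forall_mem_map.2 fun e _ => posPart_nonneg _)
        exact absurd (h c List.mem_cons_self) (by rw [hright]; exact hleft.not_ge)

variable {S : Type*} [Fintype S] {b : Finset S → WithTop ℝ} {m x y : EuclideanSpace ℝ S}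

theorem sum_map_decSeq {M : Type*} [AddCommMonoid M] (x : EuclideanSpace ℝ S) (f : ℝ → M) :
    ((decSeq x).map f).sum = ∑ v, f (x v) := by
  rw [← Multiset.sum_coe, ← Multiset.map_coe, decSeq, Multiset.sort_eq, Multiset.map_map]
  rfl

theorem decSmaller_or_valueEquivalent_of_sum_posPart_sub_le
    (h : ∀ s, ∑ v, (x v - y s)⁺ ≤ ∑ v, (y v - y s)⁺) :
    DecSmaller x y ∨ ValueEquivalent x y := by
  refine lex_or_eq_of_sum_posPart_sub_le (by simp [decSeq]) (Multiset.pairwise_sort _ _)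
    fun c hc => ?_
  obtain ⟨s, rfl⟩ : ∃ s, y s = c := by simpa [decSeq] using hc
  simpa only [sum_map_decSeq] using h s

theorem sum_compl_le_of_isTight [DecidableEq S] (hx : x ∈ basePolyhedron b)
    (hy : y ∈ basePolyhedron b) {L : Finset S} (hL : IsTight b x L) :
    ∑ v ∈ Lᶜ, x v ≤ ∑ v ∈ Lᶜ, y v := by
  have htotal : ∑ v, x v = ∑ v, y v := WithTop.coe_injective (hx.1.trans hy.1.symm)
  have hle : ∑ v ∈ L, y v ≤ ∑ v ∈ L, x v := WithTop.coe_le_coe.1 ((hy.2 L).trans_eq hL.symm)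
  rw [← Finset.sum_add_sum_compl L x, ← Finset.sum_add_sum_compl L y] at htotal
  linarith

theorem sum_posPart_sub_le_of_isTight (hx : x ∈ basePolyhedron b) (hy : y ∈ basePolyhedron b)
    {L : Finset S} (hL : IsTight b x L) {c : ℝ} (hle : ∀ v ∈ L, x v ≤ c)
    (hge : ∀ v ∉ L, c ≤ x v) : ∑ v, (x v - c)⁺ ≤ ∑ v, (y v - c)⁺ := by
  classical
  have hinside : ∑ v ∈ L, (x v - c)⁺ = 0 := Finset.sum_eq_zero fun v hv =>
    posPart_eq_zero.2 (sub_nonpos.2 (hle v hv))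
  calc ∑ v, (x v - c)⁺ = ∑ v ∈ Lᶜ, (x v - c)⁺ := by
        rw [← Finset.sum_add_sum_compl L, hinside, zero_add]
    _ = ∑ v ∈ Lᶜ, (x v - c) := Finset.sum_congr rfl fun v hv =>
        posPart_eq_self.2 (sub_nonneg.2 (hge v (Finset.mem_compl.1 hv)))
    _ ≤ ∑ v ∈ Lᶜ, (y v - c) := by
        simpa only [Finset.sum_sub_distrib, sub_le_sub_iff_right] using
          sum_compl_le_of_isTight hx hy hL
    _ ≤ ∑ v ∈ Lᶜ, (y v - c)⁺ := Finset.sum_le_sum fun v _ => le_posPart _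
    _ ≤ ∑ v, (y v - c)⁺ := Finset.sum_le_univ_sum_of_nonneg fun v => posPart_nonneg _

/-- The points of the base-polyhedron obtained by rounding each coordinate of `m` up or down,
possibly only part of the way, while keeping the integral level sets of `m` tight. When `m` is the
minimum norm point, `m` itself belongs to this polytope. -/
def roundingPolytope (b : Finset S → WithTop ℝ) (m : EuclideanSpace ℝ S) :
    Set (EuclideanSpace ℝ S) :=
  tightFace b (Set.range fun k : ℤ => lowerLevelSet m k) ∩ box (fun v => ⌊m v⌋) (fun v => ⌈m v⌉)

theorem IsMinNormPoint.mem_roundingPolytope [DecidableEq S] (h0 : b ∅ = 0)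
    (hb : IsSubmodular b) (hm : IsMinNormPoint (basePolyhedron b) m) :
    m ∈ roundingPolytope b m :=
  ⟨⟨hm.1, Set.forall_mem_range.2 fun k => hm.isTight_lowerLevelSet h0 hb k⟩,
    fun v => ⟨Int.floor_le (m v), Int.le_ceil (m v)⟩⟩

theorem isDecMin_of_mem_integralPoints_roundingPolytope
    (hx : x ∈ integralPoints (roundingPolytope b m)) :
    IsDecMin (integralPoints (basePolyhedron b)) x := by
  obtain ⟨⟨⟨hxB, htight⟩, hbox⟩, hint⟩ := hx
  refine ⟨⟨hxB, hint⟩, fun y hy => decSmaller_or_valueEquivalent_of_sum_posPart_sub_le fun s => ?_⟩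
  obtain ⟨k, hk⟩ := hy.2 s
  rw [hk]
  refine sum_posPart_sub_le_of_isTight hxB hy.1 (htight _ ⟨k, rfl⟩) (fun v hv => ?_) fun v hv => ?_
  · exact (hbox v).2.trans (Int.cast_le.2 (Int.ceil_le.2 (mem_lowerLevelSet.1 hv)))
  · have hkv : (k : ℝ) ≤ m v := (not_le.1 (mem_lowerLevelSet.not.1 hv)).le
    exact (Int.cast_le.2 (Int.le_floor.2 hkv)).trans (hbox v).1

end DecMin

theorem IsIntegralBasePolyhedron.exists_isSubmodular_real {S : Type*} [Fintype S] [DecidableEq S]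
    {B : Set (EuclideanSpace ℝ S)} (hB : IsIntegralBasePolyhedron B) :
    ∃ b : Finset S → WithTop ℝ, b ∅ = 0 ∧ IsSubmodular b ∧
      (∀ Z (c : ℝ), b Z = c → c ∈ (Int.castAddHom ℝ).range) ∧ B = basePolyhedron b := by
  obtain ⟨b, h0, hb, rfl⟩ := hB
  refine ⟨_, by simp [h0], hb.map (Int.castAddHom ℝ) Int.cast_mono, fun Z c hc => ?_, rfl⟩
  obtain ⟨k, -, hk⟩ := WithTop.map_eq_some_iff.1 hc
  exact ⟨k, hk⟩

theorem mainTheorem8 {S : Type*} [Fintype S] [DecidableEq S]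
    (B : Set (EuclideanSpace ℝ S)) (hB : IsIntegralBasePolyhedron B) (hne : B.Nonempty) :
    (∃! m, IsMinNormPoint B m) ∧
      ∀ m, IsMinNormPoint B m → m ∈ convexHull ℝ {x | IsDecMin (integralPoints B) x} := by
  obtain ⟨b, h0, hb, hbint, rfl⟩ := hB.exists_isSubmodular_real
  refine ⟨existsUnique_isMinNormPoint hne (isClosed_basePolyhedron b) (convex_basePolyhedron b),
    fun m hm => ?_⟩
  have hround : roundingPolytope b m ⊆ convexHull ℝ (integralPoints (roundingPolytope b m)) :=
    tightFace_inter_box_subset_convexHull_integralPoints hb hbint (fun v => ⟨⌊m v⌋, rfl⟩)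
      fun v => ⟨⌈m v⌉, rfl⟩
  have hdec : integralPoints (roundingPolytope b m) ⊆
      {x | IsDecMin (integralPoints (basePolyhedron b)) x} := fun x hx =>
    isDecMin_of_mem_integralPoints_roundingPolytope hx
  exact convexHull_mono hdec (hround (hm.mem_roundingPolytope h0 hb))
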